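/- Let $\mathbb{F}$ be a field and let $1,\alpha,\beta\in\mathbb{F}$ be distinct. Let $A$ be a commutative, not necessarily associative $\mathbb{F}$-algebra; for $a\in A$ and $\lambda\in\mathbb{F}$ put $A_\lambda(a)=\{x\in A: ax=\lambda x\}$. A nonzero idempotent $a\in A$ is called a $\mathcal{J}(\alpha,\beta)$-axis if $A=A_1(a)\oplus A_\alpha(a)\oplus A_\beta(a)$ and $$A_1(a)A_\lambda(a)\subseteq A_\lambda(a)\ (\lambda\in\{1,\alpha,\beta\}),\quad A_\alpha(a)^2\subseteq A_1(a)\oplus A_\alpha(a),\quad A_\alpha(a)A_\beta(a)\subseteq A_\beta(a),\quad A_\beta(a)^2\subseteq A_1(a)\oplus A_\alpha(a);$$ it is primitive if moreover $A_1(a)=\mathbb{F}a$. We say that $A$ satisfies $(\star)$ if for any two primitive $\mathcal{J}(\alpha,\beta)$-axes $a,b\in A$ with $b=xa+b_\alpha+b_\beta$, where $x\in\mathbb{F}$, $b_\alpha\in A_\alpha(a)$, $b_\beta\in A_\beta(a)$, the projection of $a$ onto $A_1(b)$ (along $A_\alpha(b)\oplus A_\beta(b)$) equals $xb$. Suppose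 that $A$ satisfies $(\star)$ and is generated as an $\mathbb{F}$-algebra by three primitive $\mathcal{J}(\alpha,\beta)$-axes $a,b,c$. Then $A$ is spanned as an $\mathbb{F}$-vector space by $$a,\ b,\ c,\ ab,\ ac,\ bc,\ a(bc),\ b(ac),\ c(ab).$$ If in addition $A_\alpha(a)^2\subseteq A_1(a)$ (for the generating axis $a$), then $A$ is spanned by the eight elements $$a,\ b,\ c,\ ab,\ ac,\ bc,\ a(bc),\ b(ac).$$ -/

import Mathlib

namespace AxialAlg

/-- A fusion law over `F`: a subset of `F` with a map from pairs of its elements to its subsets. -/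
structure FusionLaw (F : Type*) where
  carrier : Set F
  op : carrier → carrier → Set carrier

/-- The fusion law `J(α, β)` on `{1, α, β}` (intended for distinct `1, α, β`):
`1 * l = {l} = l * 1`, `α * α = {1, α}`, `α * β = β * α = {β}`, `β * β = {1, α}`. -/
def JLaw {F : Type*} [Field F] (α β : F) : FusionLaw F where
  carrier := {1, α, β}
  op := fun l m => {n |
    (l.1 = 1 ∧ n = m) ∨ (m.1 = 1 ∧ n = l) ∨
    (l.1 = α ∧ m.1 = α ∧ (n.1 = 1 ∨ n.1 = α)) ∨
    (l.1 = α ∧ m.1 = β ∧ n.1 = β) ∨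
    (l.1 = β ∧ m.1 = α ∧ n.1 = β) ∨
    (l.1 = β ∧ m.1 = β ∧ (n.1 = 1 ∨ n.1 = α))}

section

variable (F : Type*) [Field F] {A : Type*} [NonUnitalNonAssocCommRing A] [Module F A]
  [IsScalarTower F A A] [SMulCommClass F A A]

/-- The (possibly trivial) eigenspace `A_l(a)` of the multiplication operator `x ↦ a * x`. -/
def eigen (a : A) (l : F) : Submodule F A :=
  Module.End.eigenspace (LinearMap.mulLeft F a) l

variable {F}

/-- `a` is an axis for the fusion law `L`: a nonzero idempotent (so that `1` is an eigenvalue of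
its multiplication operator) such that `A` is the direct sum of the eigenspaces `A_l(a)`, `l ∈ L`,
and these multiply according to `L`. -/
structure IsAxis (L : FusionLaw F) (a : A) : Prop where
  ne_zero : a ≠ 0
  idem : a * a = a
  indep : iSupIndep (fun l : L.carrier => eigen F a l.1)
  iSup_eq_top : ⨆ l : L.carrier, eigen F a l.1 = ⊤
  fusion : ∀ l m : L.carrier, ∀ x ∈ eigen F a l.1, ∀ y ∈ eigen F a m.1,
    x * y ∈ ⨆ n ∈ L.op l m, eigen F a n.1

/-- An axis is primitive if its `1`-eigenspace is the line that it spans. -/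
structure IsPrimitiveAxis (L : FusionLaw F) (a : A) : Prop extends IsAxis L a where
  primitive : eigen F a 1 = Submodule.span F {a}

variable (A) in
/-- The condition (⋆): for any two primitive `J(α, β)`-axes `a, b` of `A`, if
`b = x a + b_α + b_β` is the decomposition of `b` with respect to `a`, then the projection of `a`
onto `A_1(b)` is `x b`. -/
def StarCondition (α β : F) : Prop :=
  ∀ a b : A, IsPrimitiveAxis (JLaw α β) a → IsPrimitiveAxis (JLaw α β) b →
    ∀ x : F, ∀ bα ∈ eigen F a α, ∀ bβ ∈ eigen F a β, b = x • a + bα + bβ →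
      ∃ aα ∈ eigen F b α, ∃ aβ ∈ eigen F b β, a = x • b + aα + aβ

end

end AxialAlg

namespace AxialAlg

section

variable {F : Type*} [Field F] {A : Type*} [NonUnitalNonAssocCommRing A] [Module F A]
  [SMulCommClass F A A] {α β : F} {a : A}

/-! The fusion law is `ℤ/2`-graded, with even part `A_1(a) ⊕ A_α(a)` and odd part `A_β(a)`. Let `P`
be the projection onto the odd part and `δ = β - α ≠ 0`. By primitivity `a * x` equals `α • x + δ •
P x` modulo `a`, so for a subspace `V` containing `a` and `x`, `a * x ∈ V` iff `P x ∈ V`. Questions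
about multiplication by an axis thus become identities between even and odd parts.

Let `V` be the span of the nine elements. It is stable under each axis: the only hard products have
the shape `a * (x * (a * y))`, settled by `mul_mul_mul_mem`. By `mul_mul_mem_of_forall_mul_mem`, if
`V` is stable under `v`, it is stable under `a * v`; hence it is stable under all nine generators
and is a subalgebra. For eight elements, `mul_mul_mem_of_alpha_alpha` expresses `c * (a * b)`
through the others. -/

theorem mem_eigen_iff {l : F} {x : A} : x ∈ eigen F a l ↔ a * x = l • x := by
  simp [eigen]

/-! ### Eigenvector decomposition and fusion rules. -/

theorem IsAxis.exists_decomposition (ha : IsAxis (JLaw α β) a) (x : A) :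
    ∃ w ∈ eigen F a 1, ∃ u ∈ eigen F a α, ∃ v ∈ eigen F a β, x = w + u + v := by
  have hx : x ∈ eigen F a 1 ⊔ eigen F a α ⊔ eigen F a β := by
    have hle : ⨆ l : (JLaw α β).carrier, eigen F a l.1 ≤
        eigen F a 1 ⊔ eigen F a α ⊔ eigen F a β := by
      refine iSup_le ?_
      rintro ⟨l, rfl | rfl | rfl⟩
      · exact le_sup_of_le_left le_sup_left
      · exact le_sup_of_le_left le_sup_right
      · exact le_sup_right
    exact hle (ha.iSup_eq_top ▸ Submodule.mem_top)
  obtain ⟨y, hy, v, hv, rfl⟩ := Submodule.mem_sup.1 hx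
  obtain ⟨w, hw, u, hu, rfl⟩ := Submodule.mem_sup.1 hy
  exact ⟨w, hw, u, hu, v, hv, rfl⟩

theorem mem_JLaw_op_iff {F : Type*} [Field F] {α β : F} {l m n : (JLaw α β).carrier} :
    n ∈ (JLaw α β).op l m ↔
      (l.1 = 1 ∧ n = m) ∨ (m.1 = 1 ∧ n = l) ∨
      (l.1 = α ∧ m.1 = α ∧ (n.1 = 1 ∨ n.1 = α)) ∨ (l.1 = α ∧ m.1 = β ∧ n.1 = β) ∨
      (l.1 = β ∧ m.1 = α ∧ n.1 = β) ∨ (l.1 = β ∧ m.1 = β ∧ (n.1 = 1 ∨ n.1 = α)) :=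
  Iff.rfl

theorem IsAxis.mul_mem_of_alpha_alpha (ha : IsAxis (JLaw α β) a) (hα : α ≠ 1) (hαβ : α ≠ β)
    {x y : A} (hx : x ∈ eigen F a α) (hy : y ∈ eigen F a α) :
    x * y ∈ eigen F a 1 ⊔ eigen F a α := by
  have h := ha.fusion ⟨α, by simp [JLaw]⟩ ⟨α, by simp [JLaw]⟩ x hx y hy
  refine (iSup₂_le ?_ : _ ≤ eigen F a 1 ⊔ eigen F a α) h
  intro n hn
  have hn : n.1 = 1 ∨ n.1 = α := by simpa [mem_JLaw_op_iff, hα, hαβ] using hn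
  rcases hn with hn | hn <;> rw [hn]
  exacts [le_sup_left, le_sup_right]

theorem IsAxis.mul_mem_of_beta_beta (ha : IsAxis (JLaw α β) a) (hβ : β ≠ 1) (hαβ : α ≠ β)
    {x y : A} (hx : x ∈ eigen F a β) (hy : y ∈ eigen F a β) :
    x * y ∈ eigen F a 1 ⊔ eigen F a α := by
  have h := ha.fusion ⟨β, by simp [JLaw]⟩ ⟨β, by simp [JLaw]⟩ x hx y hy
  refine (iSup₂_le ?_ : _ ≤ eigen F a 1 ⊔ eigen F a α) h
  intro n hn
  have hn : n.1 = 1 ∨ n.1 = α := by simpa [mem_JLaw_op_iff, hβ, hαβ.symm] using hn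
  rcases hn with hn | hn <;> rw [hn]
  exacts [le_sup_left, le_sup_right]

theorem IsAxis.mul_mem_of_alpha_beta (ha : IsAxis (JLaw α β) a) (hα : α ≠ 1) (hβ : β ≠ 1)
    (hαβ : α ≠ β) {x y : A} (hx : x ∈ eigen F a α) (hy : y ∈ eigen F a β) :
    x * y ∈ eigen F a β := by
  have h := ha.fusion ⟨α, by simp [JLaw]⟩ ⟨β, by simp [JLaw]⟩ x hx y hy
  refine (iSup₂_le ?_ : _ ≤ eigen F a β) h
  intro n hn
  have hn : n.1 = β := by simpa [mem_JLaw_op_iff, hα, hβ, hαβ, hαβ.symm] using hn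
  rw [hn]

theorem IsPrimitiveAxis.exists_smul (ha : IsPrimitiveAxis (JLaw α β) a) {w : A}
    (hw : w ∈ eigen F a 1) : ∃ t : F, w = t • a := by
  rw [ha.primitive] at hw
  obtain ⟨t, rfl⟩ := Submodule.mem_span_singleton.1 hw
  exact ⟨t, rfl⟩

/-! ### The odd projection of an axis. -/

variable (α β a) in
/-- The projection onto the `β`-eigenspace of `a`, as a polynomial in the multiplication by `a`. -/
noncomputable def betaProj : A →ₗ[F] A :=
  ((β - 1) * (β - α))⁻¹ • ((LinearMap.mulLeft F a - (1 : F) • LinearMap.id) ∘ₗ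
    (LinearMap.mulLeft F a - α • LinearMap.id))

theorem betaProj_of_mem {x : A} (hβ : β ≠ 1) (hαβ : α ≠ β) (hx : x ∈ eigen F a β) :
    betaProj α β a x = x := by
  rw [mem_eigen_iff] at hx
  have h1 := sub_ne_zero.2 hβ
  have h2 := sub_ne_zero.2 hαβ.symm
  have : betaProj α β a x = ((β - 1) * (β - α))⁻¹ • (((β - 1) * (β - α)) • x) := by
    simp only [betaProj, LinearMap.smul_apply, LinearMap.comp_apply, LinearMap.sub_apply,
      LinearMap.mulLeft_apply, LinearMap.id_apply, hx, mul_sub, mul_smul_comm]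
    module
  rw [this, inv_smul_smul₀ (mul_ne_zero h1 h2)]

theorem betaProj_of_mem_alpha {x : A} (hx : x ∈ eigen F a α) : betaProj α β a x = 0 := by
  rw [mem_eigen_iff] at hx
  simp [betaProj, hx]

theorem betaProj_of_mem_one {x : A} (hx : x ∈ eigen F a 1) : betaProj α β a x = 0 := by
  rw [mem_eigen_iff, one_smul] at hx
  simp [betaProj, hx, mul_sub, mul_smul_comm]

theorem betaProj_of_mem_sup {x : A} (hx : x ∈ eigen F a 1 ⊔ eigen F a α) :
    betaProj α β a x = 0 := by
  obtain ⟨w, hw, u, hu, rfl⟩ := Submodule.mem_sup.1 hx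
  rw [map_add, betaProj_of_mem_one hw, betaProj_of_mem_alpha hu, add_zero]

/-- The data of a primitive `J(α, β)`-axis `a` in terms of the projection onto its `β`-eigenspace:
multiplication by `a`, and the `ℤ/2`-grading of the algebra. -/
structure IsGradingProj (δ α : F) (a : A) (P : A →ₗ[F] A) : Prop where
  map_self : P a = 0
  map_map : ∀ x, P (P x) = P x
  mul_eq : ∀ x, ∃ t : F, a * x = α • x + δ • P x + t • a
  odd_odd : ∀ x y, P (P x * P y) = 0
  even_even : ∀ x y, P ((x - P x) * (y - P y)) = 0
  even_odd : ∀ x y, P ((x - P x) * P y) = (x - P x) * P y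
  even_mem : ∀ x, ∃ t : F, x - P x - t • a ∈ eigen F a α

theorem IsPrimitiveAxis.isGradingProj [IsScalarTower F A A]
    (ha : IsPrimitiveAxis (JLaw α β) a) (hα : α ≠ 1)
    (hβ : β ≠ 1) (hαβ : α ≠ β) : IsGradingProj (β - α) α a (betaProj α β a) := by
  have key : ∀ x, ∃ t : F, ∃ u ∈ eigen F a α, ∃ v ∈ eigen F a β, x = t • a + u + v ∧
      betaProj α β a x = v := by
    intro x
    obtain ⟨w, hw, u, hu, v, hv, rfl⟩ := ha.toIsAxis.exists_decomposition x
    refine ⟨_, u, hu, v, hv, by rw [← (ha.exists_smul hw).choose_spec], ?_⟩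
    rw [map_add, map_add, betaProj_of_mem_one hw, betaProj_of_mem_alpha hu,
      betaProj_of_mem hβ hαβ hv, zero_add, zero_add]
  have ha1 : a ∈ eigen F a 1 := by rw [mem_eigen_iff, ha.idem, one_smul]
  constructor
  · exact betaProj_of_mem_one ha1
  · intro x
    obtain ⟨t, u, hu, v, hv, rfl, hP⟩ := key x
    rw [hP, betaProj_of_mem hβ hαβ hv]
  · intro x
    obtain ⟨t, u, hu, v, hv, rfl, hP⟩ := key x
    rw [mem_eigen_iff] at hu hv
    refine ⟨(1 - α) * t, ?_⟩
    rw [hP, mul_add, mul_add, hu, hv, mul_smul_comm, ha.idem]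
    module
  · intro x y
    obtain ⟨t, u, hu, v, hv, rfl, hP⟩ := key x
    obtain ⟨t', u', hu', v', hv', rfl, hP'⟩ := key y
    rw [hP, hP']
    exact betaProj_of_mem_sup (ha.toIsAxis.mul_mem_of_beta_beta hβ hαβ hv hv')
  · intro x y
    obtain ⟨t, u, hu, v, hv, rfl, hP⟩ := key x
    obtain ⟨t', u', hu', v', hv', rfl, hP'⟩ := key y
    rw [hP, hP', add_sub_cancel_right, add_sub_cancel_right]
    have huu := betaProj_of_mem_sup (β := β) (ha.toIsAxis.mul_mem_of_alpha_alpha hα hαβ hu hu')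
    have e := mem_eigen_iff.1 hu
    have e' := mem_eigen_iff.1 hu'
    rw [add_mul, mul_add, mul_add, smul_mul_smul_comm, ha.idem, smul_mul_assoc, e',
      mul_smul_comm, mul_comm u a, e]
    simp only [map_add, map_smul, huu, betaProj_of_mem_one ha1, betaProj_of_mem_alpha hu,
      betaProj_of_mem_alpha hu', smul_zero, add_zero]
  · intro x y
    obtain ⟨t, u, hu, v, hv, rfl, hP⟩ := key x
    obtain ⟨t', u', hu', v', hv', rfl, hP'⟩ := key y
    rw [hP, hP', add_sub_cancel_right, add_mul, smul_mul_assoc, mem_eigen_iff.1 hv', map_add,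
      map_smul, map_smul, betaProj_of_mem hβ hαβ hv',
      betaProj_of_mem hβ hαβ (ha.toIsAxis.mul_mem_of_alpha_beta hα hβ hαβ hu hv')]
  · intro x
    obtain ⟨t, u, hu, v, hv, rfl, hP⟩ := key x
    refine ⟨t, ?_⟩
    rwa [hP, add_sub_cancel_right, add_sub_cancel_left]

/-! ### Subspaces containing the axis, and the grading identities. -/

namespace IsGradingProj

variable {δ : F} {P : A →ₗ[F] A}

theorem odd_even (h : IsGradingProj δ α a P) (x y : A) :
    P (P x * (y - P y)) = P x * (y - P y) := by
  rw [mul_comm, h.even_odd]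

theorem map_mem_iff (h : IsGradingProj δ α a P) (hδ : δ ≠ 0) {V : Submodule F A} (ha : a ∈ V)
    {x : A} (hx : x ∈ V) : P x ∈ V ↔ a * x ∈ V := by
  obtain ⟨t, ht⟩ := h.mul_eq x
  rw [ht, V.add_mem_iff_left (V.smul_mem t ha), V.add_mem_iff_right (V.smul_mem α hx),
    V.smul_mem_iff hδ]

theorem mul_map_mem_iff (h : IsGradingProj δ α a P) (hδ : δ ≠ 0) {V : Submodule F A} {x y : A}
    (hax : a * x ∈ V) (hxy : x * y ∈ V) : x * P y ∈ V ↔ x * (a * y) ∈ V := by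
  obtain ⟨t, ht⟩ := h.mul_eq y
  rw [ht, mul_add, mul_add, mul_smul_comm, mul_smul_comm, mul_smul_comm, mul_comm x a,
    V.add_mem_iff_left (V.smul_mem t hax), V.add_mem_iff_right (V.smul_mem α hxy),
    V.smul_mem_iff hδ]

/-- Only the mixed even-odd products are odd. -/
theorem map_mul (h : IsGradingProj δ α a P) (x y : A) :
    P (x * y) = (x - P x) * P y + P x * (y - P y) := by
  have e : x * y = (x - P x) * (y - P y) + (x - P x) * P y + P x * (y - P y) + P x * P y := by
    simp only [sub_mul, mul_sub]; abel
  rw [e, map_add, map_add, map_add, h.even_even, h.even_odd, h.odd_even, h.odd_odd, zero_add,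
    add_zero]

theorem mul_mul_self_mem (h : IsGradingProj δ α a P) (hδ : δ ≠ 0) {V : Submodule F A}
    (ha : a ∈ V) {x : A} (hx : x ∈ V) (hax : a * x ∈ V) : a * (a * x) ∈ V := by
  rw [← h.map_mem_iff hδ ha hax]
  have hP := (h.map_mem_iff hδ ha hx).2 hax
  obtain ⟨t, ht⟩ := h.mul_eq x
  rw [ht, map_add, map_add, map_smul, map_smul, map_smul, h.map_self, h.map_map]
  exact V.add_mem (V.add_mem (V.smul_mem _ hP) (V.smul_mem _ hP)) (V.smul_mem _ V.zero_mem)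

theorem map_eq_zero_of_two_eq_zero (h : IsGradingProj δ α a P) (h2 : (2 : F) = 0) {x : A}
    (hx : x * x = x) : P x = 0 := by
  have e := h.map_mul x x
  rw [hx, mul_comm (P x), ← two_smul F, h2, zero_smul] at e
  exact e

/-- Up to easier terms this asks for `P (x * P y) = x * P y - P x * P y`, so the point is to get `P
x * P y` into `V`. -/
theorem mul_mul_mul_mem (h : IsGradingProj δ α a P) (hδ : δ ≠ 0) {V : Submodule F A} {x y : A}
    (hy : y * y = y) (ha : a ∈ V) (hxV : x ∈ V)
    (hax : a * x ∈ V) (hay : a * y ∈ V) (hxy : x * y ∈ V) (haxy : a * (x * y) ∈ V)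
    (hxay : x * (a * y) ∈ V) (hyax : y * (a * x) ∈ V) : a * (x * (a * y)) ∈ V := by
  -- In characteristic 2 the idempotent `y` is even, so `a * y` is a combination of `y` and `a`.
  by_cases h2 : (2 : F) = 0
  · obtain ⟨t, ht⟩ := h.mul_eq y
    rw [ht, h.map_eq_zero_of_two_eq_zero h2 hy, smul_zero, add_zero, mul_add, mul_add,
      mul_smul_comm, mul_smul_comm, mul_smul_comm, mul_smul_comm, mul_comm x a]
    exact V.add_mem (V.smul_mem _ haxy) (V.smul_mem _ (h.mul_mul_self_mem hδ ha hxV hax))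
  · have h1 : x * P y ∈ V := (h.mul_map_mem_iff hδ hax hxy).2 hxay
    have h1' : y * P x ∈ V :=
      (h.mul_map_mem_iff hδ hay (by rwa [mul_comm])).2 hyax
    have h3 : P (x * y) ∈ V := (h.map_mem_iff hδ ha hxy).2 haxy
    have h4 : P x * P y ∈ V := by
      rw [← V.smul_mem_iff h2]
      -- The two mixed products cancel against `P (x * y)`, leaving the odd-odd product twice.
      have e : (2 : F) • (P x * P y) = x * P y + y * P x - P (x * y) := by
        rw [h.map_mul, two_smul, sub_mul, mul_sub, mul_comm y]; abel
      rw [e]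
      exact V.sub_mem (V.add_mem h1 h1') h3
    have h5 : P (x * P y) ∈ V := by
      have e : P (x * P y) = x * P y - P x * P y := by
        rw [h.map_mul, h.map_map, sub_self, mul_zero, add_zero, sub_mul]
      rw [e]
      exact V.sub_mem h1 h4
    obtain ⟨t, ht⟩ := h.mul_eq y
    have h6 : a * (x * P y) ∈ V := (h.map_mem_iff hδ ha h1).1 h5
    rw [ht, mul_add, mul_add, mul_add, mul_add, mul_smul_comm, mul_smul_comm, mul_smul_comm,
      mul_smul_comm, mul_smul_comm, mul_smul_comm, mul_comm x a]
    exact V.add_mem (V.add_mem (V.smul_mem _ haxy) (V.smul_mem _ h6))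
      (V.smul_mem _ (h.mul_mul_self_mem hδ ha hxV hax))

/-- If the products of `α`-eigenvectors lie on the line of the axis, then `a (x y)`, `x (a y)` and
`y (a x)` are linearly dependent modulo the products of length two. -/
theorem mul_mul_mem_of_alpha_alpha [IsScalarTower F A A]
    (h : IsGradingProj δ α a P) (hδ : δ ≠ 0) {V : Submodule F A}
    {x y : A} (hα : ∀ u ∈ eigen F a α, ∀ v ∈ eigen F a α, u * v ∈ V) (haa : a * a = a)
    (ha : a ∈ V) (hxV : x ∈ V) (hyV : y ∈ V) (hax : a * x ∈ V) (hay : a * y ∈ V)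
    (hxy : x * y ∈ V) (haxy : a * (x * y) ∈ V) (hxay : x * (a * y) ∈ V) :
    y * (a * x) ∈ V := by
  have h1 : x * P y ∈ V := (h.mul_map_mem_iff hδ hax hxy).2 hxay
  have h3 : P (x * y) ∈ V := (h.map_mem_iff hδ ha hxy).2 haxy
  have hyx : y * x ∈ V := by rwa [mul_comm]
  rw [← h.mul_map_mem_iff hδ hay hyx]
  have hev : (x - P x) * (y - P y) ∈ V := by
    have aux : ∀ z ∈ V, a * z ∈ V → a * (z - P z) ∈ V := by
      intro z hz haz
      have hPz := (h.map_mem_iff hδ ha hz).2 haz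
      rw [mul_sub]
      refine V.sub_mem haz ((h.map_mem_iff hδ ha hPz).1 ?_)
      rwa [h.map_map]
    -- An even part is a multiple of `a` plus an `α`-eigenvector; `aux` handles the cross terms.
    obtain ⟨s, hs⟩ := h.even_mem x
    obtain ⟨t, ht⟩ := h.even_mem y
    have e : (x - P x) * (y - P y) = (x - P x - s • a) * (y - P y - t • a) +
        s • (a * (y - P y)) + t • (a * (x - P x)) - (s * t) • a := by
      rw [sub_mul (x - P x) (s • a), mul_sub (x - P x) _ (t • a), mul_sub (s • a) _ (t • a),
        smul_mul_smul_comm, haa, smul_mul_assoc, mul_smul_comm, mul_comm (x - P x) a]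
      abel
    rw [e]
    exact V.sub_mem (V.add_mem (V.add_mem (hα _ hs _ ht) (V.smul_mem _ (aux y hyV hay)))
      (V.smul_mem _ (aux x hxV hax))) (V.smul_mem _ ha)
  have e : y * P x = x * y + x * y - P (x * y) - x * P y - (x - P x) * (y - P y)
      - (x - P x) * (y - P y) := by
    rw [h.map_mul]
    simp only [sub_mul, mul_sub, mul_comm y (P x)]
    abel
  rw [e]
  exact V.sub_mem (V.sub_mem (V.sub_mem (V.sub_mem (V.add_mem hxy hxy) h3) h1) hev) hev

/-- It suffices to treat `P v * w`. Its two pieces, with `w` replaced by its even and odd parts, are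
the odd part of `v * (w - P w)` and the even part of `v * P w`. -/
theorem mul_mul_mem_of_forall_mul_mem [IsScalarTower F A A] (h : IsGradingProj δ α a P) (hδ : δ ≠ 0)
    {V : Submodule F A} (ha : a ∈ V) (haV : ∀ w ∈ V, a * w ∈ V) {v : A}
    (hv : ∀ w ∈ V, v * w ∈ V) {w : A} (hw : w ∈ V) : (a * v) * w ∈ V := by
  have hP : ∀ w ∈ V, P w ∈ V := fun w hw ↦ (h.map_mem_iff hδ ha hw).2 (haV w hw)
  have e : P v * w = P (v * (w - P w)) + (v * P w - P (v * P w)) := by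
    rw [h.map_mul, h.map_mul, map_sub, h.map_map, sub_self, mul_zero, mul_zero]
    simp only [sub_mul, mul_sub, sub_zero]
    abel
  have h1 : P v * w ∈ V := by
    rw [e]
    exact V.add_mem (hP _ (hv _ (V.sub_mem hw (hP w hw))))
      (V.sub_mem (hv _ (hP w hw)) (hP _ (hv _ (hP w hw))))
  obtain ⟨t, ht⟩ := h.mul_eq v
  rw [ht, add_mul, add_mul, smul_mul_assoc, smul_mul_assoc, smul_mul_assoc]
  exact V.add_mem (V.add_mem (V.smul_mem _ (hv w hw)) (V.smul_mem _ h1)) (V.smul_mem _ (haV w hw))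

end IsGradingProj

/-! ### The spanning sets. -/

theorem eq_top_of_mul_mem [IsScalarTower F A A] {V : Submodule F A} {S : Set A}
    (hS : NonUnitalAlgebra.adjoin F S = ⊤) (hSV : S ⊆ V) (hV : ∀ v ∈ V, ∀ w ∈ V, v * w ∈ V) :
    V = ⊤ := by
  let B : NonUnitalSubalgebra F A := { V with mul_mem' := fun {v w} hv hw ↦ hV v hv w hw }
  have hB : NonUnitalAlgebra.adjoin F S ≤ B := NonUnitalAlgebra.adjoin_le hSV
  rw [hS] at hB
  exact eq_top_iff.2 fun x _ ↦ hB (NonUnitalAlgebra.mem_top (R := F) (x := x))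

theorem span_nine_eq_top [IsScalarTower F A A] (hα : α ≠ 1) (hβ : β ≠ 1) (hαβ : α ≠ β) {b c : A}
    (ha : IsPrimitiveAxis (JLaw α β) a) (hb : IsPrimitiveAxis (JLaw α β) b)
    (hc : IsPrimitiveAxis (JLaw α β) c)
    (hgen : NonUnitalAlgebra.adjoin F ({a, b, c} : Set A) = ⊤) :
    Submodule.span F
      ({a, b, c, a * b, a * c, b * c, a * (b * c), b * (a * c), c * (a * b)} : Set A) = ⊤ := by
  have hδ : β - α ≠ 0 := sub_ne_zero.2 hαβ.symm
  have Ha := ha.isGradingProj hα hβ hαβ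
  have Hb := hb.isGradingProj hα hβ hαβ
  have Hc := hc.isGradingProj hα hβ hαβ
  set S : Set A := {a, b, c, a * b, a * c, b * c, a * (b * c), b * (a * c), c * (a * b)} with hS
  set V := Submodule.span F S with hV
  have mem : ∀ x ∈ S, x ∈ V := fun x hx ↦ Submodule.subset_span hx
  have ma : a ∈ V := mem _ (by simp [hS])
  have mb : b ∈ V := mem _ (by simp [hS])
  have mc : c ∈ V := mem _ (by simp [hS])
  have mab : a * b ∈ V := mem _ (by simp [hS])
  have mac : a * c ∈ V := mem _ (by simp [hS])
  have mbc : b * c ∈ V := mem _ (by simp [hS])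
  have mabc : a * (b * c) ∈ V := mem _ (by simp [hS])
  have mbac : b * (a * c) ∈ V := mem _ (by simp [hS])
  have mcab : c * (a * b) ∈ V := mem _ (by simp [hS])
  have mba : b * a ∈ V := by rwa [mul_comm]
  have mca : c * a ∈ V := by rwa [mul_comm]
  have mcb : c * b ∈ V := by rwa [mul_comm]
  have macb : a * (c * b) ∈ V := by rwa [mul_comm c]
  have mbca : b * (c * a) ∈ V := by rwa [mul_comm c]
  have mcba : c * (b * a) ∈ V := by rwa [mul_comm b]
  have closed : ∀ x, (∀ s ∈ S, x * s ∈ V) → ∀ v ∈ V, x * v ∈ V := fun x hx ↦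
    (Submodule.span_le (p := V.comap (LinearMap.mulLeft F x))).2 hx
  have cla : ∀ v ∈ V, a * v ∈ V := by
    apply closed
    rintro s (rfl | rfl | rfl | rfl | rfl | rfl | rfl | rfl | rfl)
    · rwa [ha.idem]
    · exact mab
    · exact mac
    · exact Ha.mul_mul_self_mem hδ ma mb mab
    · exact Ha.mul_mul_self_mem hδ ma mc mac
    · exact mabc
    · exact Ha.mul_mul_self_mem hδ ma mbc mabc
    · exact Ha.mul_mul_mul_mem hδ hc.idem ma mb mab mac mbc mabc mbac mcab
    · exact Ha.mul_mul_mul_mem hδ hb.idem ma mc mac mab mcb macb mcab mbac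
  have clb : ∀ v ∈ V, b * v ∈ V := by
    apply closed
    rintro s (rfl | rfl | rfl | rfl | rfl | rfl | rfl | rfl | rfl)
    · exact mba
    · rwa [hb.idem]
    · exact mbc
    · rw [mul_comm a]
      exact Hb.mul_mul_self_mem hδ mb ma mba
    · exact mbac
    · exact Hb.mul_mul_self_mem hδ mb mc mbc
    · exact Hb.mul_mul_mul_mem hδ hc.idem mb ma mba mbc mac mbac mabc mcba
    · exact Hb.mul_mul_self_mem hδ mb mac mbac
    · rw [mul_comm a]
      exact Hb.mul_mul_mul_mem hδ ha.idem mb mc mbc mba mca mbca mcba mabc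
  have clc : ∀ v ∈ V, c * v ∈ V := by
    apply closed
    rintro s (rfl | rfl | rfl | rfl | rfl | rfl | rfl | rfl | rfl)
    · exact mca
    · exact mcb
    · rwa [hc.idem]
    · exact mcab
    · rw [mul_comm a]
      exact Hc.mul_mul_self_mem hδ mc ma mca
    · rw [mul_comm b]
      exact Hc.mul_mul_self_mem hδ mc mb mcb
    · rw [mul_comm b]
      exact Hc.mul_mul_mul_mem hδ hb.idem mc ma mca mcb mab mcab macb mbca
    · rw [mul_comm a]
      exact Hc.mul_mul_mul_mem hδ ha.idem mc mb mcb mca mba mcba mbca macb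
    · exact Hc.mul_mul_self_mem hδ mc mab mcab
  refine eq_top_of_mul_mem hgen ?_ ?_
  · rintro x (rfl | rfl | rfl)
    exacts [ma, mb, mc]
  · intro v hv w hw
    -- Every generator is an iterated left product of axes, so stability propagates from `a`, `b`,
    -- `c` to all nine.
    have na {v : A} (hv : ∀ w ∈ V, v * w ∈ V) : ∀ w ∈ V, (a * v) * w ∈ V := fun w hw ↦
      Ha.mul_mul_mem_of_forall_mul_mem hδ ma cla hv hw
    have nb {v : A} (hv : ∀ w ∈ V, v * w ∈ V) : ∀ w ∈ V, (b * v) * w ∈ V := fun w hw ↦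
      Hb.mul_mul_mem_of_forall_mul_mem hδ mb clb hv hw
    have nc {v : A} (hv : ∀ w ∈ V, v * w ∈ V) : ∀ w ∈ V, (c * v) * w ∈ V := fun w hw ↦
      Hc.mul_mul_mem_of_forall_mul_mem hδ mc clc hv hw
    rw [mul_comm]
    refine closed w ?_ v hv
    rintro s (rfl | rfl | rfl | rfl | rfl | rfl | rfl | rfl | rfl) <;> rw [mul_comm]
    exacts [cla w hw, clb w hw, clc w hw, na clb w hw, na clc w hw, nb clc w hw,
      na (nb clc) w hw, nb (na clc) w hw, nc (na clb) w hw]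

theorem span_eight_eq_top [IsScalarTower F A A] (hα : α ≠ 1) (hβ : β ≠ 1) (hαβ : α ≠ β) {b c : A}
    (ha : IsPrimitiveAxis (JLaw α β) a)
    (hαα : ∀ x ∈ eigen F a α, ∀ y ∈ eigen F a α, x * y ∈ eigen F a 1)
    (h9 : Submodule.span F
      ({a, b, c, a * b, a * c, b * c, a * (b * c), b * (a * c), c * (a * b)} : Set A) = ⊤) :
    Submodule.span F
      ({a, b, c, a * b, a * c, b * c, a * (b * c), b * (a * c)} : Set A) = ⊤ := by
  have hδ : β - α ≠ 0 := sub_ne_zero.2 hαβ.symm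
  set S : Set A := {a, b, c, a * b, a * c, b * c, a * (b * c), b * (a * c)} with hS
  set V := Submodule.span F S with hV
  have mem : ∀ x ∈ S, x ∈ V := fun x hx ↦ Submodule.subset_span hx
  have ma : a ∈ V := mem _ (by simp [hS])
  have h1 : ∀ x ∈ eigen F a α, ∀ y ∈ eigen F a α, x * y ∈ V := by
    intro x hx y hy
    obtain ⟨t, ht⟩ := ha.exists_smul (hαα x hx y hy)
    rw [ht]
    exact V.smul_mem t ma
  have mcab : c * (a * b) ∈ V :=
    (ha.isGradingProj hα hβ hαβ).mul_mul_mem_of_alpha_alpha hδ h1 ha.idem ma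
      (mem _ (by simp [hS])) (mem _ (by simp [hS])) (mem _ (by simp [hS])) (mem _ (by simp [hS]))
      (mem _ (by simp [hS])) (mem _ (by simp [hS])) (mem _ (by simp [hS]))
  rw [eq_top_iff, ← h9, Submodule.span_le]
  rintro x (hx | hx | hx | hx | hx | hx | hx | hx | hx)
  on_goal 9 => rw [Set.mem_singleton_iff.1 hx]; exact mcab
  all_goals exact mem _ (by simp [hS, hx])

end

end AxialAlg

theorem mainTheorem8 {F : Type*} [Field F] {A : Type*} [NonUnitalNonAssocCommRing A] [Module F A]
    [IsScalarTower F A A] [SMulCommClass F A A]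
    (α β : F) (hα : α ≠ 1) (hβ : β ≠ 1) (hαβ : α ≠ β)
    (a b c : A)
    (ha : AxialAlg.IsPrimitiveAxis (AxialAlg.JLaw α β) a)
    (hb : AxialAlg.IsPrimitiveAxis (AxialAlg.JLaw α β) b)
    (hc : AxialAlg.IsPrimitiveAxis (AxialAlg.JLaw α β) c)
    (hgen : NonUnitalAlgebra.adjoin F ({a, b, c} : Set A) = ⊤)
    (hstar : AxialAlg.StarCondition A α β) :
    Submodule.span F
        ({a, b, c, a * b, a * c, b * c, a * (b * c), b * (a * c), c * (a * b)} : Set A) = ⊤ ∧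
    ((∀ x ∈ AxialAlg.eigen F a α, ∀ y ∈ AxialAlg.eigen F a α, x * y ∈ AxialAlg.eigen F a 1) →
      Submodule.span F
        ({a, b, c, a * b, a * c, b * c, a * (b * c), b * (a * c)} : Set A) = ⊤) := by
  have h9 := AxialAlg.span_nine_eq_top hα hβ hαβ ha hb hc hgen
  exact ⟨h9, fun hαα ↦ AxialAlg.span_eight_eq_top hα hβ hαβ ha hαα h9⟩
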